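/- For a ring $\Lambda$ (associative, with identity), let $\mathrm{sfli}\,\Lambda$ denote the supremum of the flat dimensions of injective left $\Lambda$-modules, and let $\mathrm{silf}\,\Lambda$ denote the supremum of the injective dimensions of flat left $\Lambda$-modules. Let $R$ be a commutative Gorenstein ring, that is, a commutative noetherian ring which has finite injective dimension as a module over itself. Let $G$ be a group such that the group ring $RG$ is left noetherian. Then $\mathrm{sfli}\,RG < \infty$ if and only if $\mathrm{silf}\,RG < \infty$. In this case, one has $\mathrm{sfli}\,RG = \mathrm{silf}\,RG$. -/

import Mathlib

open CategoryTheory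
open scoped TensorProduct

universe u v

/-- The subgroup of `N ⊗_ℤ M` generated by the elements `n·a ⊗ m - n ⊗ a·m`, for a right module `N`
(that is, a module over `Λᵐᵒᵖ`) and a left module `M` over the ring `Λ`. -/
def balancedRelations (Λ : Type*) [Ring Λ] (N : Type*) [AddCommGroup N] [Module Λᵐᵒᵖ N]
    (M : Type*) [AddCommGroup M] [Module Λ M] : AddSubgroup (N ⊗[ℤ] M) :=
  AddSubgroup.closure {x | ∃ (n : N) (a : Λ) (m : M),
    x = (MulOpposite.op a • n) ⊗ₜ[ℤ] m - n ⊗ₜ[ℤ] (a • m)}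

/-- The tensor product `N ⊗_Λ M` of a right and a left module over a (not necessarily commutative)
ring `Λ`: the quotient of `N ⊗_ℤ M` by the relations `n·a ⊗ m = n ⊗ a·m`. -/
abbrev BalancedTensor (Λ : Type*) [Ring Λ] (N : Type*) [AddCommGroup N] [Module Λᵐᵒᵖ N]
    (M : Type*) [AddCommGroup M] [Module Λ M] : Type _ :=
  (N ⊗[ℤ] M) ⧸ balancedRelations Λ N M

theorem balancedRelations_le_comap {Λ : Type*} [Ring Λ]
    {N N' : Type*} [AddCommGroup N] [Module Λᵐᵒᵖ N] [AddCommGroup N'] [Module Λᵐᵒᵖ N']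
    (f : N →ₗ[Λᵐᵒᵖ] N') (M : Type*) [AddCommGroup M] [Module Λ M] :
    balancedRelations Λ N M ≤
      (balancedRelations Λ N' M).comap (f.toAddMonoidHom.toIntLinearMap.rTensor M).toAddMonoidHom := by
  refine (AddSubgroup.closure_le _).mpr ?_
  rintro _ ⟨n, a, m, rfl⟩
  refine AddSubgroup.subset_closure ⟨f n, a, m, ?_⟩
  simp

/-- The map `f ⊗_Λ M : N ⊗_Λ M → N' ⊗_Λ M` induced by a homomorphism `f : N → N'` of
right `Λ`-modules. -/
def BalancedTensor.map {Λ : Type*} [Ring Λ]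
    {N N' : Type*} [AddCommGroup N] [Module Λᵐᵒᵖ N] [AddCommGroup N'] [Module Λᵐᵒᵖ N']
    (f : N →ₗ[Λᵐᵒᵖ] N') (M : Type*) [AddCommGroup M] [Module Λ M] :
    BalancedTensor Λ N M →+ BalancedTensor Λ N' M :=
  QuotientAddGroup.map _ _ (f.toAddMonoidHom.toIntLinearMap.rTensor M).toAddMonoidHom
    (balancedRelations_le_comap f M)

/-- A left module `M` over a (not necessarily commutative) ring `Λ` is flat if `- ⊗_Λ M` preserves
injectivity of homomorphisms of right `Λ`-modules. -/
def IsFlatModule (Λ : Type u) [Ring Λ] (M : Type v) [AddCommGroup M] [Module Λ M] : Prop :=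
  ∀ ⦃N N' : Type u⦄ [AddCommGroup N] [Module Λᵐᵒᵖ N] [AddCommGroup N'] [Module Λᵐᵒᵖ N']
    (f : N →ₗ[Λᵐᵒᵖ] N'), Function.Injective f → Function.Injective (BalancedTensor.map f M)

/-- `HasFlatDimensionLT Λ n M` says that `M` has flat dimension `< n`: there is an exact sequence
`0 → F_{n-1} → ⋯ → F_1 → F_0 → M → 0` with `n` flat modules `F_i`. The sequence is built
one short exact sequence `0 → K → F → M → 0` at a time; `n = 0` means `M = 0`. -/
def HasFlatDimensionLT (Λ : Type u) [Ring Λ] : ℕ → ModuleCat.{v} Λ → Prop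
  | 0, M => Subsingleton M
  | n + 1, M => ∃ (F : ModuleCat.{v} Λ) (p : F →ₗ[Λ] M), IsFlatModule Λ F ∧
      Function.Surjective p ∧ HasFlatDimensionLT Λ n (ModuleCat.of Λ (LinearMap.ker p))

/-- The flat dimension of a left `Λ`-module, with the same conventions as for Mathlib's
`CategoryTheory.injectiveDimension`: it is `⊥` for the zero module and `⊤` if there is no
finite flat resolution. -/
noncomputable def flatDimension {Λ : Type u} [Ring Λ] (M : ModuleCat.{v} Λ) : WithBot ℕ∞ :=
  sInf {n : WithBot ℕ∞ | ∀ i : ℕ, n < i → HasFlatDimensionLT Λ i M}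

/-- `silf Λ`: the supremum of the injective dimensions of flat left `Λ`-modules. -/
noncomputable def silf (Λ : Type u) [Ring Λ] : WithBot ℕ∞ :=
  ⨆ (F : ModuleCat.{u} Λ) (_ : IsFlatModule Λ F), injectiveDimension F

/-- `sfli Λ`: the supremum of the flat dimensions of injective left `Λ`-modules. -/
noncomputable def sfli (Λ : Type u) [Ring Λ] : WithBot ℕ∞ :=
  ⨆ (I : ModuleCat.{u} Λ) (_ : Module.Injective Λ I), flatDimension I

/-- A commutative Gorenstein ring: a commutative noetherian ring of finite injective dimension
as a module over itself. -/
structure IsCommGorensteinRing (R : Type u) [CommRing R] : Prop where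
  isNoetherianRing : IsNoetherianRing R
  injectiveDimension_lt_top : injectiveDimension (ModuleCat.of R R) < ⊤

-- Inverting group elements gives `RG` an involution, so the character dual M* = Hom(M, ℚ/ℤ) of a
-- left module is again a left module. Tensor-hom adjunction shows that M is flat iff M* is
-- injective (`isFlatModule_iff_injective_starDual`), and dualizing resolutions then gives fd M = id
-- M* (`flatDimension_eq`).
--
-- Over a left noetherian ring ideals are finitely presented. This makes E** injective whenever E
-- is, and conversely makes M injective whenever M** is; dimension shifting turns the latter into id
-- M ≤ id M**.
--
-- If E is injective, then E* is flat, so fd E = id E* ≤ `silf`. If F is flat, then F* is injective,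
-- so id F ≤ id F** = fd F* ≤ `sfli`. Hence the two invariants always agree, finite or not.

universe w

/-- A linear map to a Baer module extends along any linear map whose kernel it kills. -/
theorem Module.Baer.exists_comp_eq_of_ker_le {Λ : Type*} [Ring Λ] {Q X Y : Type*} [AddCommGroup Q]
    [Module Λ Q] [AddCommGroup X] [Module Λ X] [AddCommGroup Y] [Module Λ Y]
    (hQ : Module.Baer Λ Q) (p : X →ₗ[Λ] Y) (q : X →ₗ[Λ] Q)
    (h : LinearMap.ker p ≤ LinearMap.ker q) : ∃ e : Y →ₗ[Λ] Q, e ∘ₗ p = q := by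
  obtain ⟨e, he⟩ := hQ.extension_property ((LinearMap.ker p).liftQ p le_rfl)
    (LinearMap.ker_eq_bot.mp (Submodule.ker_liftQ_eq_bot' _ p rfl)) ((LinearMap.ker p).liftQ q h)
  refine ⟨e, LinearMap.ext fun x ↦ ?_⟩
  simpa using LinearMap.congr_fun he (Submodule.Quotient.mk x)

/-! ### Characters of abelian groups -/

namespace CharacterModule

/-- A character extends along any homomorphism whose kernel it kills. -/
theorem exists_comp_eq {X Y : Type*} [AddCommGroup X] [AddCommGroup Y] (p : X →+ Y)
    (q : CharacterModule X) (h : ∀ x, p x = 0 → q x = 0) :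
    ∃ e : CharacterModule Y, ∀ x, e (p x) = q x := by
  obtain ⟨e, he⟩ := (Module.Baer.of_divisible (A := AddCircle (1 : ℚ))).exists_comp_eq_of_ker_le
    p.toIntLinearMap (AddMonoidHom.toIntLinearMap q) h
  exact ⟨e.toAddMonoidHom, fun x ↦ LinearMap.congr_fun he x⟩

/-- Precomposition of characters with a homomorphism, as an additive map. -/
def comap {X Y : Type*} [AddCommGroup X] [AddCommGroup Y] (p : X →+ Y) :
    CharacterModule Y →+ CharacterModule X where
  toFun c := AddMonoidHom.comp c p
  map_zero' := rfl
  map_add' _ _ := rfl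

@[simp] theorem comap_apply {X Y : Type*} [AddCommGroup X] [AddCommGroup Y] (p : X →+ Y)
    (c : CharacterModule Y) (x : X) : comap p c x = c (p x) := rfl

theorem apply_pi_eq_sum {ι : Type*} [Fintype ι] [DecidableEq ι] {A : Type*} [AddCommGroup A]
    (c : CharacterModule (ι → A)) (v : ι → A) : c v = ∑ i, c (Pi.single i (v i)) := by
  conv_lhs => rw [← Finset.univ_sum_single v]
  exact map_sum c _ _

/-- Taking characters twice preserves exactness. -/
theorem exists_comap_comap_eq {A B C : Type*} [AddCommGroup A] [AddCommGroup B] [AddCommGroup C]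
    (f : A →+ B) (g : B →+ C) (hfg : ∀ b, g b = 0 → ∃ a, f a = b)
    (m : CharacterModule (CharacterModule B)) (hm : ∀ χ, m (comap g χ) = 0) :
    ∃ x : CharacterModule (CharacterModule A), ∀ ψ, x (comap f ψ) = m ψ := by
  -- It suffices that `m` kills every ψ vanishing on the image of `f`; by exactness such a ψ factors
  -- through `g`.
  refine exists_comp_eq _ _ fun ψ hψ ↦ ?_
  obtain ⟨χ, hχ⟩ := exists_comp_eq g ψ fun b hb ↦ by
    obtain ⟨a, rfl⟩ := hfg b hb
    exact DFunLike.congr_fun hψ a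
  rw [← hm χ]
  exact congrArg m (DFunLike.ext _ _ fun b ↦ (hχ b).symm)

end CharacterModule

/-! ### The dual of a left module over a ring with involution -/

section StarDual

variable (Λ : Type w)

/-- The character module of a left module over a ring with involution, as a left module. -/
def StarDual (_ : Type w) (M : Type*) [AddCommGroup M] : Type _ := CharacterModule M

namespace StarDual

variable (M : Type*) [AddCommGroup M]

instance : AddCommGroup (StarDual Λ M) := inferInstanceAs (AddCommGroup (CharacterModule M))

instance : FunLike (StarDual Λ M) M (AddCircle (1 : ℚ)) :=
  inferInstanceAs (FunLike (CharacterModule M) M _)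

instance : AddMonoidHomClass (StarDual Λ M) M (AddCircle (1 : ℚ)) where
  map_add c := AddMonoidHom.map_add c
  map_zero c := AddMonoidHom.map_zero c

variable {Λ M}

@[ext] theorem ext {c d : StarDual Λ M} (h : ∀ x, c x = d x) : c = d := DFunLike.ext _ _ h

@[simp] theorem add_apply (c d : StarDual Λ M) (x : M) : (c + d) x = c x + d x := rfl

@[simp] theorem zero_apply (x : M) : (0 : StarDual Λ M) x = 0 := rfl

theorem sum_apply {ι : Type*} (s : Finset ι) (c : ι → StarDual Λ M) (x : M) :
    (∑ i ∈ s, c i) x = ∑ i ∈ s, c i x :=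
  map_sum (AddMonoidHom.eval x : (M →+ AddCircle (1 : ℚ)) →+ _) c s

theorem subsingleton_iff : Subsingleton (StarDual Λ M) ↔ Subsingleton M := by
  constructor
  · intro h
    refine subsingleton_of_forall_eq 0 fun x ↦ CharacterModule.eq_zero_of_character_apply fun c ↦ ?_
    exact DFunLike.congr_fun (h.elim (c : StarDual Λ M) 0) x
  · intro h
    refine ⟨fun c d ↦ ext fun x ↦ ?_⟩
    rw [Subsingleton.elim x 0, map_zero, map_zero]

variable [Ring Λ] [StarRing Λ] [Module Λ M]

/-- Characters naturally carry a right action, precomposition with `r`; `star` reverses products and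
makes it a left one. -/
instance : Module Λ (StarDual Λ M) where
  smul r c := AddMonoidHom.comp c (DistribSMul.toAddMonoidHom M (star r))
  one_smul c := ext fun x ↦ congrArg c (by simp)
  mul_smul r s c := ext fun x ↦ congrArg c (by simp [mul_smul])
  smul_zero _ := rfl
  smul_add _ _ _ := rfl
  add_smul r s c := ext fun x ↦ (congrArg c (by simp [add_smul])).trans (map_add c _ _)
  zero_smul c := ext fun x ↦ (congrArg c (by simp)).trans (map_zero c)

@[simp] theorem smul_apply (r : Λ) (c : StarDual Λ M) (x : M) : (r • c) x = c (star r • x) := rfl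

/-- The map of duals induced by a linear map. -/
def map {N : Type*} [AddCommGroup N] [Module Λ N] (f : M →ₗ[Λ] N) :
    StarDual Λ N →ₗ[Λ] StarDual Λ M where
  toFun c := CharacterModule.comap f.toAddMonoidHom c
  map_add' _ _ := rfl
  map_smul' _ c := ext fun x ↦ congrArg c (map_smul f _ x).symm

@[simp] theorem map_apply {N : Type*} [AddCommGroup N] [Module Λ N] (f : M →ₗ[Λ] N)
    (c : StarDual Λ N) (x : M) : map f c x = c (f x) := rfl

theorem map_exact {N P : Type*} [AddCommGroup N] [Module Λ N] [AddCommGroup P] [Module Λ P]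
    {f : M →ₗ[Λ] N} {g : N →ₗ[Λ] P} (h : Function.Exact f g) :
    Function.Exact (map g) (map f) := by
  intro c
  constructor
  · intro hc
    obtain ⟨e, he⟩ := CharacterModule.exists_comp_eq g.toAddMonoidHom c fun x hx ↦ by
      obtain ⟨a, rfl⟩ := (h x).mp hx
      exact DFunLike.congr_fun hc a
    exact ⟨e, ext he⟩
  · rintro ⟨e, rfl⟩
    exact ext fun x ↦ by simp [h.apply_apply_eq_zero]

theorem map_injective {N : Type*} [AddCommGroup N] [Module Λ N] {f : M →ₗ[Λ] N}
    (hf : Function.Surjective f) : Function.Injective (map f) := fun c d h ↦ ext fun y ↦ by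
  obtain ⟨x, rfl⟩ := hf y
  exact DFunLike.congr_fun h x

theorem map_surjective {N : Type*} [AddCommGroup N] [Module Λ N] {f : M →ₗ[Λ] N}
    (hf : Function.Injective f) : Function.Surjective (map f) := fun c ↦ by
  obtain ⟨e, he⟩ := CharacterModule.exists_comp_eq f.toAddMonoidHom c fun x hx ↦ by
    rw [hf (hx.trans (map_zero f).symm)]
    exact map_zero c
  exact ⟨e, ext he⟩

/-- Evaluation, as a linear map to the double dual. -/
def eval : M →ₗ[Λ] StarDual Λ (StarDual Λ M) where
  toFun x := ((AddMonoidHom.eval x : (M →+ AddCircle (1 : ℚ)) →+ _) :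
    CharacterModule (CharacterModule M))
  map_add' x y := ext fun c ↦ map_add c x y
  map_smul' r x := ext fun c ↦ congrArg c (by simp)

@[simp] theorem eval_apply (x : M) (c : StarDual Λ M) :
    (eval x : StarDual Λ (StarDual Λ M)) c = c x := rfl

end StarDual

end StarDual

/-! ### Flatness through injectivity of the dual -/

section Flat

variable {Λ : Type w} [Ring Λ] [StarRing Λ]

/-- A module over a ring with involution is flat iff its dual is injective. -/
theorem isFlatModule_iff_injective_starDual (M : Type w) [AddCommGroup M] [Module Λ M] :
    IsFlatModule Λ M ↔ Module.Injective Λ (StarDual Λ M) := by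
  constructor
  · intro hM
    refine ⟨fun X Y _ _ _ _ f hf g ↦ ?_⟩
    let _ : Module Λᵐᵒᵖ X := Module.compHom X (starRingEquiv (R := Λ)).symm.toRingHom
    let _ : Module Λᵐᵒᵖ Y := Module.compHom Y (starRingEquiv (R := Λ)).symm.toRingHom
    have hX (a : Λ) (x : X) : MulOpposite.op a • x = star a • x := rfl
    have hY (a : Λ) (y : Y) : MulOpposite.op a • y = star a • y := rfl
    let f' : X →ₗ[Λᵐᵒᵖ] Y :=
      { f with map_smul' := fun a x ↦ map_smul f (star a.unop) x }
    -- Adjunction: a linear map `X → M*` is the same as a character of the balanced tensor product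
    -- `X ⊗ M`. Flatness lets that character extend to `Y ⊗ M`.
    let b : X ⊗[ℤ] M →+ AddCircle (1 : ℚ) :=
      TensorProduct.liftAddHom (g.toAddMonoidHom : X →+ (M →+ AddCircle (1 : ℚ))) fun r x m ↦ by
        change (g (r • x)) m = g x (r • m)
        rw [map_zsmul, map_zsmul]; rfl
    have hb (x : X) (m : M) : b (x ⊗ₜ m) = g x m := rfl
    let b' : BalancedTensor Λ X M →+ AddCircle (1 : ℚ) :=
      QuotientAddGroup.lift _ b <| (AddSubgroup.closure_le _).mpr <| by
        rintro _ ⟨x, a, m, rfl⟩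
        change b _ = 0
        rw [map_sub, hb, hb, hX, map_smul, StarDual.smul_apply, star_star, sub_self]
    obtain ⟨c, hc⟩ := CharacterModule.exists_comp_eq (BalancedTensor.map f' M) b' fun x hx ↦ by
      rw [hM f' hf (hx.trans (map_zero _).symm)]
      exact map_zero b'
    let t (y : Y) (m : M) : BalancedTensor Λ Y M := QuotientAddGroup.mk (y ⊗ₜ m)
    let h (y : Y) : StarDual Λ M := (AddMonoidHom.mk' (fun m ↦ c (t y m)) fun m m' ↦ by
      simp [t, TensorProduct.tmul_add] : M →+ AddCircle (1 : ℚ))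
    refine ⟨⟨⟨h, fun y y' ↦ ?_⟩, fun a y ↦ ?_⟩, fun x ↦ ?_⟩
    · ext m
      change c (t _ _) = c (t _ _) + c (t _ _)
      simp [t, TensorProduct.add_tmul]
    · ext m
      rw [RingHom.id_apply, StarDual.smul_apply]
      change c (t _ _) = c (t _ _)
      refine congrArg c ((QuotientAddGroup.eq_iff_sub_mem).mpr (AddSubgroup.subset_closure ?_))
      exact ⟨y, star a, m, by rw [hY, star_star]⟩
    · ext m
      exact hc (QuotientAddGroup.mk (x ⊗ₜ m))
  · intro hM N N' _ _ _ _ f hf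
    let _ : Module Λ N := Module.compHom N (starRingEquiv (R := Λ)).toRingHom
    let _ : Module Λ N' := Module.compHom N' (starRingEquiv (R := Λ)).toRingHom
    have hN (a : Λ) (x : N) : a • x = MulOpposite.op (star a) • x := rfl
    have hN' (a : Λ) (x : N') : a • x = MulOpposite.op (star a) • x := rfl
    let f' : N →ₗ[Λ] N' :=
      { f with map_smul' := fun a x ↦ map_smul f (MulOpposite.op (star a)) x }
    rw [injective_iff_map_eq_zero]
    intro z hz
    -- Characters separate points, so it is enough that each `c` factors through `f ⊗ M`: take its
    -- adjoint `N → M*`, extend it to `N'`, and pass back.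
    refine CharacterModule.eq_zero_of_character_apply fun c ↦ ?_
    let t (n : N) (m : M) : BalancedTensor Λ N M := QuotientAddGroup.mk (n ⊗ₜ m)
    let d (n : N) : StarDual Λ M := (AddMonoidHom.mk' (fun m ↦ c (t n m)) fun m m' ↦ by
      simp [t, TensorProduct.tmul_add] : M →+ AddCircle (1 : ℚ))
    let g : N →ₗ[Λ] StarDual Λ M :=
      { toFun := d
        map_add' := fun n n' ↦ by
          ext m
          change c (t _ _) = c (t _ _) + c (t _ _)
          simp [t, TensorProduct.add_tmul]
        map_smul' := fun a n ↦ by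
          ext m
          change d (a • n) m = (a • d n) m
          rw [StarDual.smul_apply]
          change c (t _ _) = c (t _ _)
          refine congrArg c ((QuotientAddGroup.eq_iff_sub_mem).mpr (AddSubgroup.subset_closure ?_))
          exact ⟨n, star a, m, by rw [hN]⟩ }
    obtain ⟨h, hh⟩ := hM.out f' hf g
    let b : N' ⊗[ℤ] M →+ AddCircle (1 : ℚ) :=
      TensorProduct.liftAddHom (h.toAddMonoidHom : N' →+ (M →+ AddCircle (1 : ℚ))) fun r x m ↦ by
        change (h (r • x)) m = h x (r • m)
        rw [map_zsmul, map_zsmul]; rfl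
    have hb (x : N') (m : M) : b (x ⊗ₜ m) = h x m := rfl
    let b' : BalancedTensor Λ N' M →+ AddCircle (1 : ℚ) :=
      QuotientAddGroup.lift _ b <| (AddSubgroup.closure_le _).mpr <| by
        rintro _ ⟨x, a, m, rfl⟩
        change b _ = 0
        have : MulOpposite.op a • x = star a • x := by rw [hN', star_star]
        rw [map_sub, hb, hb, this, map_smul, StarDual.smul_apply, star_star, sub_self]
    have key (z) : b' (BalancedTensor.map f M z) = c z := by
      obtain ⟨z, rfl⟩ := QuotientAddGroup.mk_surjective z
      induction z with
      | zero => simp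
      | add x y hx hy => simp only [QuotientAddGroup.mk_add, map_add, hx, hy]
      | tmul n m => exact DFunLike.congr_fun (hh n) m
    rw [← key, hz, map_zero]

/-- A linear map from `X` to this dual amounts to a family of characters of `X`, its values at the
basis vectors, and characters extend from submodules. -/
theorem injective_starDual_finsupp (ι : Type w) : Module.Injective Λ (StarDual Λ (ι →₀ Λ)) := by
  refine ⟨fun X Y _ _ _ _ f hf g ↦ ?_⟩
  have H (i : ι) : ∃ c : CharacterModule Y, ∀ x, c (f x) = g x (Finsupp.single i 1) := by
    refine CharacterModule.exists_comp_eq f.toAddMonoidHom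
      (AddMonoidHom.mk' (fun x ↦ g x (Finsupp.single i 1)) fun x y ↦ by simp) fun x hx ↦ ?_
    rw [hf (hx.trans (map_zero f).symm)]
    exact map_zero _
  choose c hc using H
  let h (y : Y) : StarDual Λ (ι →₀ Λ) := (Finsupp.liftAddHom fun i ↦
    AddMonoidHom.mk' (fun a ↦ c i (star a • y)) fun a b ↦ by simp [add_smul] :
      (ι →₀ Λ) →+ AddCircle (1 : ℚ))
  have hs (y : Y) (i : ι) (a : Λ) : h y (Finsupp.single i a) = c i (star a • y) :=
    Finsupp.liftAddHom_apply_single _ _ _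
  have hext {p q : StarDual Λ (ι →₀ Λ)}
      (hpq : ∀ i a, p (Finsupp.single i a) = q (Finsupp.single i a)) : p = q :=
    Finsupp.addHom_ext (N := AddCircle (1 : ℚ)) (f := p) (g := q) hpq
  refine ⟨⟨⟨h, fun y y' ↦ hext fun i a ↦ ?_⟩, fun r y ↦ hext fun i a ↦ ?_⟩,
    fun x ↦ hext fun i a ↦ ?_⟩
  · simp [hs]
  · change h (r • y) _ = (r • h y) _
    rw [hs, StarDual.smul_apply, Finsupp.smul_single, hs, smul_eq_mul, star_mul, star_star,
      mul_smul]
  · change h (f x) _ = _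
    rw [hs, ← map_smul, hc, map_smul, StarDual.smul_apply, star_star, Finsupp.smul_single, smul_eq_mul,
      mul_one]

end Flat

/-! ### Flat and injective dimensions under duality -/

section Dimension

variable {Λ : Type w} [Ring Λ]

theorem moduleInjective_iff_hasInjectiveDimensionLT_one (M : ModuleCat.{w} Λ) :
    Module.Injective Λ M ↔ HasInjectiveDimensionLT M 1 := by
  rw [← injective_iff_hasInjectiveDimensionLT_one]
  exact Module.injective_iff_injective_object Λ M

theorem hasInjectiveDimensionLT_zero_iff_subsingleton (M : ModuleCat.{w} Λ) :
    HasInjectiveDimensionLT M 0 ↔ Subsingleton M := by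
  rw [hasInjectiveDimensionLT_zero_iff_isZero, ModuleCat.isZero_iff_subsingleton]

variable [StarRing Λ]

/-- The short complex of duals of a short exact sequence of modules. -/
abbrev StarDual.shortComplex {M N P : Type w} [AddCommGroup M] [Module Λ M] [AddCommGroup N]
    [Module Λ N] [AddCommGroup P] [Module Λ P] (f : M →ₗ[Λ] N) (g : N →ₗ[Λ] P)
    (h : Function.Exact f g) : ShortComplex (ModuleCat.{w} Λ) :=
  ModuleCat.shortComplexOfCompEqZero (StarDual.map g) (StarDual.map f)
    (StarDual.map_exact h).linearMap_comp_eq_zero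

theorem StarDual.shortExact {M N P : Type w} [AddCommGroup M] [Module Λ M] [AddCommGroup N]
    [Module Λ N] [AddCommGroup P] [Module Λ P] (f : M →ₗ[Λ] N) (g : N →ₗ[Λ] P)
    (h : Function.Exact f g) (hf : Function.Injective f) (hg : Function.Surjective g) :
    (StarDual.shortComplex f g h).ShortExact :=
  ModuleCat.shortComplex_shortExact _ (StarDual.map_exact h) (StarDual.map_injective hg)
    (StarDual.map_surjective hf)

theorem StarDual.shortExact_ker {N P : Type w} [AddCommGroup N] [Module Λ N] [AddCommGroup P]
    [Module Λ P] (p : N →ₗ[Λ] P) (hp : Function.Surjective p) :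
    (StarDual.shortComplex (LinearMap.ker p).subtype p
      (LinearMap.exact_subtype_ker_map p)).ShortExact :=
  StarDual.shortExact _ p _ (LinearMap.ker p).injective_subtype hp

/-- The flat dimension of a module is the injective dimension of its dual. -/
theorem hasFlatDimensionLT_iff (n : ℕ) (M : ModuleCat.{w} Λ) :
    HasFlatDimensionLT Λ n M ↔ HasInjectiveDimensionLT (ModuleCat.of Λ (StarDual Λ M)) n := by
  induction n generalizing M with
  | zero =>
    rw [hasInjectiveDimensionLT_zero_iff_subsingleton]
    exact (StarDual.subsingleton_iff (Λ := Λ)).symm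
  | succ n ih =>
    constructor
    · rintro ⟨F, p, hF, hp, hK⟩
      rw [ih] at hK
      rw [isFlatModule_iff_injective_starDual] at hF
      have hS := StarDual.shortExact_ker p hp
      refine hS.hasInjectiveDimensionLT_X₁ n hK ?_
      have := (moduleInjective_iff_hasInjectiveDimensionLT_one
        (ModuleCat.of Λ (StarDual Λ F))).mp hF
      exact hasInjectiveDimensionLT_of_ge _ 1 (n + 1) (by lia)
    · intro hM
      -- Dimension `< 1` is treated apart: the kernel must then vanish, so the cover is `M` itself.
      -- Above that, a free cover works by dimension shifting.
      obtain _ | n := n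
      · refine ⟨M, LinearMap.id, ?_, Function.surjective_id, ?_⟩
        · rw [isFlatModule_iff_injective_starDual]
          exact (moduleInjective_iff_hasInjectiveDimensionLT_one _).mpr hM
        · change Subsingleton (LinearMap.ker LinearMap.id)
          rw [LinearMap.ker_id]
          infer_instance
      · let p : (M →₀ Λ) →ₗ[Λ] M := Finsupp.linearCombination Λ id
        have hp : Function.Surjective p := Finsupp.linearCombination_id_surjective Λ M
        refine ⟨ModuleCat.of Λ (M →₀ Λ), p, ?_, hp, ?_⟩
        · exact (isFlatModule_iff_injective_starDual _).mpr (injective_starDual_finsupp M)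
        · rw [ih]
          have hS := StarDual.shortExact_ker p hp
          refine (hS.hasInjectiveDimensionLT_X₃_iff n ?_).mpr hM
          exact (Module.injective_iff_injective_object Λ _).mp (injective_starDual_finsupp M)

theorem flatDimension_eq (M : ModuleCat.{w} Λ) :
    flatDimension M = injectiveDimension (ModuleCat.of Λ (StarDual Λ M)) := by
  simp only [flatDimension, injectiveDimension, hasFlatDimensionLT_iff]

/-! ### Double duals over a left noetherian ring -/

/-- Over a left noetherian ring with involution, the double dual of an injective module is
injective. -/
theorem Module.Injective.starDual_starDual [IsNoetherianRing Λ] {E : Type w} [AddCommGroup E]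
    [Module Λ E] (hE : Module.Injective Λ E) :
    Module.Injective Λ (StarDual Λ (StarDual Λ E)) := by
  refine Module.Baer.injective fun I φ ↦ ?_
  obtain ⟨b, g, hg⟩ := Submodule.fg_iff_exists_fin_generating_family.mp (IsNoetherian.noetherian I)
  -- A finite presentation `Λ^a → Λ^b → I → 0`, with relations `r`. Applying `Hom(-, E)` gives `α :
  -- E → E^b` and `β : E^b → E^a`, exact in the middle because `E` is injective.
  let p : (Fin b → Λ) →ₗ[Λ] Λ := Fintype.linearCombination Λ g
  have hpI : LinearMap.range p = I := (Fintype.range_linearCombination Λ g).trans hg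
  obtain ⟨a, r, hr⟩ := Submodule.fg_iff_exists_fin_generating_family.mp
    (IsNoetherian.noetherian (LinearMap.ker p))
  have hrp (i : Fin a) : p (r i) = 0 := by
    change r i ∈ LinearMap.ker p
    rw [← hr]
    exact Submodule.subset_span ⟨i, rfl⟩
  let α : E →+ (Fin b → E) := AddMonoidHom.mk' (fun x j ↦ g j • x) fun x y ↦ by
    ext j; simp
  let β : (Fin b → E) →+ (Fin a → E) := AddMonoidHom.mk' (fun m i ↦ ∑ j, r i j • m j) fun x y ↦ by
    ext i; simp [Finset.sum_add_distrib]
  have hαβ (m : Fin b → E) (hm : β m = 0) : ∃ x, α x = m := by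
    obtain ⟨e, he⟩ := (Module.Baer.of_injective hE).exists_comp_eq_of_ker_le p
      (Fintype.linearCombination Λ m) <| by
        rw [← hr, Submodule.span_le]
        rintro _ ⟨i, rfl⟩
        exact congrFun hm i
    refine ⟨e 1, funext fun j ↦ ?_⟩
    have := LinearMap.congr_fun he (Pi.single j 1)
    simp only [p, LinearMap.comp_apply, Fintype.linearCombination_apply_single, one_smul] at this
    change g j • e 1 = m j
    rw [← this, ← map_smul, smul_eq_mul, mul_one]
  have hgI (j : Fin b) : g j ∈ I := hg ▸ Submodule.subset_span ⟨j, rfl⟩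
  let m (j : Fin b) : StarDual Λ (StarDual Λ E) := φ ⟨g j, hgI j⟩
  have hφ (c : Fin b → Λ) (hc : p c ∈ I) : φ ⟨p c, hc⟩ = ∑ j, c j • m j := by
    simp only [m, ← map_smul, ← map_sum]
    congr 1
    ext
    simp [p, Fintype.linearCombination_apply]
  have hrm (i : Fin a) : ∑ j, r i j • m j = 0 := by
    rw [← hφ (r i) (by rw [hrp]; exact I.zero_mem), ← map_zero φ]
    congr 1
    exact Subtype.ext (hrp i)
  let s (j : Fin b) : E →+ (Fin b → E) := AddMonoidHom.single (fun _ ↦ E) j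
  -- The values of `φ` on the generators, seen in `(E^b)** = (E**)^b`. They satisfy the relations
  -- `r`, so `m'` is killed by `β**` and comes from some `x` in `E**`, which will be the value at 1
  -- of the extension.
  let m' : CharacterModule (CharacterModule (Fin b → E)) :=
    AddMonoidHom.mk' (fun ψ ↦ ∑ j, m j (CharacterModule.comap (s j) ψ)) fun x y ↦ by
      simp only [map_add, ← Finset.sum_add_distrib]
      exact Finset.sum_congr rfl fun j _ ↦ map_add (m j) _ _
  have hm' (ψ) : m' ψ = ∑ j, m j (CharacterModule.comap (s j) ψ) := rfl
  obtain ⟨x, hx⟩ := CharacterModule.exists_comap_comap_eq α β hαβ m' fun χ ↦ by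
    let χ' (i : Fin a) : StarDual Λ E :=
      CharacterModule.comap (AddMonoidHom.single (fun _ ↦ E) i) χ
    have hχ (j : Fin b) : CharacterModule.comap (s j) (CharacterModule.comap β χ) =
        ∑ i, star (r i j) • χ' i := by
      refine StarDual.ext (Λ := Λ) fun y ↦ ?_
      rw [StarDual.sum_apply]
      refine (CharacterModule.apply_pi_eq_sum χ _).trans (Finset.sum_congr rfl fun i _ ↦ ?_)
      rw [StarDual.smul_apply, star_star]
      refine congrArg (fun z ↦ χ (Pi.single i z)) ?_
      change ∑ k, r i k • (Pi.single j y : Fin b → E) k = r i j • y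
      simp [Pi.single_apply]
    rw [hm']
    calc ∑ j, m j (CharacterModule.comap (s j) (CharacterModule.comap β χ))
        = ∑ j, ∑ i, (r i j • m j) (χ' i) := by
          refine Finset.sum_congr rfl fun j _ ↦ ?_
          rw [hχ]
          exact map_sum (m j) _ _
      _ = ∑ i, (∑ j, r i j • m j) (χ' i) := by
          rw [Finset.sum_comm]
          simp only [StarDual.sum_apply]
      _ = 0 := by simp only [hrm, StarDual.zero_apply, Finset.sum_const_zero]
  let x' : StarDual Λ (StarDual Λ E) := x
  refine ⟨LinearMap.toSpanSingleton Λ _ x', fun y hy ↦ ?_⟩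
  -- Testing `α** x = m'` on characters of `E^b` that factor through the `j`-th coordinate.
  have hxm (j : Fin b) : g j • x' = m j := by
    ext χ
    have h := hx (CharacterModule.comap (Pi.evalAddMonoidHom (fun _ ↦ E) j) χ)
    rw [hm', Finset.sum_eq_single j] at h
    · refine Eq.trans ?_ (h.trans ?_)
      · refine congrArg x' (StarDual.ext (Λ := Λ) fun y ↦ ?_)
        change (star (g j) • χ) y = χ (g j • y)
        rw [StarDual.smul_apply, star_star]
      · refine congrArg (m j) (StarDual.ext (Λ := Λ) fun y ↦ congrArg χ ?_)
        simp [s]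
    · intro k _ hk
      refine (congrArg (m k) (StarDual.ext (Λ := Λ) fun y ↦ ?_)).trans (map_zero (m k))
      refine (congrArg χ ?_).trans (map_zero χ)
      simp [s, hk.symm]
    · simp
  obtain ⟨c, rfl⟩ : y ∈ LinearMap.range p := hpI ▸ hy
  rw [hφ, LinearMap.toSpanSingleton_apply]
  simp only [← hxm, p, Fintype.linearCombination_apply, Finset.sum_smul, smul_smul, smul_eq_mul]

/-- Over a left noetherian ring with involution, a module is injective if its double dual is. -/
theorem Module.Injective.of_starDual_starDual [IsNoetherianRing Λ] {M : Type w} [AddCommGroup M]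
    [Module Λ M] (hM : Module.Injective Λ (StarDual Λ (StarDual Λ M))) :
    Module.Injective Λ M := by
  refine Module.Baer.injective fun I φ ↦ ?_
  obtain ⟨b, g, hg⟩ := Submodule.fg_iff_exists_fin_generating_family.mp (IsNoetherian.noetherian I)
  obtain ⟨e, he⟩ := Module.Baer.of_injective hM I (StarDual.eval ∘ₗ φ)
  have hgI (j : Fin b) : g j ∈ I := hg ▸ Submodule.subset_span ⟨j, rfl⟩
  let α : M →+ (Fin b → M) := AddMonoidHom.mk' (fun x j ↦ g j • x) fun x y ↦ by
    ext j; simp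
  let m (j : Fin b) : M := φ ⟨g j, hgI j⟩
  -- The system `g j • x = m j` is solved by `e 1` in `M**`; this forces a solution in `M`. A
  -- character of `M^b` killing the image of `α` is a tuple ψ with `∑ star (g j) • ψ j = 0`, and its
  -- value at `m` is `e 1` applied to this sum.
  have hm : m ∈ α.range := by
    rw [← QuotientAddGroup.eq_zero_iff]
    refine CharacterModule.eq_zero_of_character_apply fun c ↦ ?_
    let ψ (j : Fin b) : StarDual Λ M := CharacterModule.comap
      ((QuotientAddGroup.mk' α.range).comp (AddMonoidHom.single (fun _ ↦ M) j)) c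
    have hsum (n : Fin b → M) : c (QuotientAddGroup.mk n) = ∑ j, ψ j (n j) :=
      CharacterModule.apply_pi_eq_sum
        (CharacterModule.comap (QuotientAddGroup.mk' α.range) c) n
    have hψ : ∑ j, star (g j) • ψ j = 0 := by
      ext x
      rw [StarDual.sum_apply]
      simp only [StarDual.smul_apply, star_star]
      refine (hsum (α x)).symm.trans ?_
      rw [(QuotientAddGroup.eq_zero_iff (α x)).mpr (AddMonoidHom.mem_range.mpr ⟨x, rfl⟩), map_zero, StarDual.zero_apply]
    have hj (j) : ψ j (m j) = e 1 (star (g j) • ψ j) := by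
      rw [← StarDual.smul_apply, ← map_smul, smul_eq_mul, mul_one, he _ (hgI j)]
      rfl
    rw [hsum]
    simp only [hj, ← map_sum, hψ, map_zero]
  obtain ⟨x, hx⟩ := hm
  refine ⟨LinearMap.toSpanSingleton Λ _ x, fun y hy ↦ ?_⟩
  let J : Submodule Λ I := LinearMap.eqLocus
    (LinearMap.toSpanSingleton Λ _ x ∘ₗ I.subtype) φ
  have hJ : I ≤ J.map I.subtype := by
    conv_lhs => rw [← hg]
    rw [Submodule.span_le]
    rintro _ ⟨j, rfl⟩
    exact ⟨⟨g j, hgI j⟩, congrFun hx j, rfl⟩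
  obtain ⟨z, hz, rfl⟩ := hJ hy
  exact hz

/-- Dimension shifting: embed `M` in an injective `J`. Since `J**` is injective as well, the
sequence and its double dual shift dimensions in parallel, down to the case of injective modules. -/
theorem hasInjectiveDimensionLT_of_starDual_starDual [IsNoetherianRing Λ] (n : ℕ)
    (M : ModuleCat.{w} Λ)
    (hM : HasInjectiveDimensionLT (ModuleCat.of Λ (StarDual Λ (StarDual Λ M))) n) :
    HasInjectiveDimensionLT M n := by
  obtain _ | n := n
  · rw [hasInjectiveDimensionLT_zero_iff_subsingleton] at hM ⊢
    exact (StarDual.subsingleton_iff (Λ := Λ)).mp ((StarDual.subsingleton_iff (Λ := Λ)).mp hM)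
  induction n generalizing M with
  | zero =>
    rw [zero_add, ← moduleInjective_iff_hasInjectiveDimensionLT_one] at hM ⊢
    exact hM.of_starDual_starDual
  | succ n ih =>
    let ⟨J, _, f, _⟩ := EnoughInjectives.presentation M
    have hJ : Module.Injective Λ J := Module.injective_module_of_injective_object Λ J
    have hf : Function.Injective f.hom := (ModuleCat.mono_iff_injective f).mp ‹_›
    let S : ShortComplex (ModuleCat.{w} Λ) :=
      ModuleCat.shortComplexOfCompEqZero _ _ f.hom.exact_map_mkQ_range.linearMap_comp_eq_zero
    have hS := ModuleCat.shortComplex_shortExact S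
      f.hom.exact_map_mkQ_range hf (Submodule.mkQ_surjective _)
    refine (hS.hasInjectiveDimensionLT_X₃_iff n inferInstance).mp (ih _ ?_)
    have hD := StarDual.shortExact _ _
      (StarDual.map_exact f.hom.exact_map_mkQ_range)
      (StarDual.map_injective (Submodule.mkQ_surjective _)) (StarDual.map_surjective hf)
    refine (hD.hasInjectiveDimensionLT_X₃_iff n ?_).mpr hM
    exact (Module.injective_iff_injective_object Λ _).mp hJ.starDual_starDual

theorem injectiveDimension_le_starDual_starDual [IsNoetherianRing Λ] (M : ModuleCat.{w} Λ) :
    injectiveDimension M ≤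
      injectiveDimension (ModuleCat.of Λ (StarDual Λ (StarDual Λ M))) :=
  sInf_le_sInf fun _ hn i hi ↦ hasInjectiveDimensionLT_of_starDual_starDual i M (hn i hi)

/-- Over a left noetherian ring with involution, `sfli` and `silf` agree. -/
theorem sfli_eq_silf [IsNoetherianRing Λ] : sfli Λ = silf Λ := by
  refine le_antisymm (iSup₂_le fun E hE ↦ ?_) (iSup₂_le fun F hF ↦ ?_)
  · rw [flatDimension_eq]
    -- E* is flat because its dual E** is injective.
    refine le_iSup₂_of_le (ModuleCat.of Λ (StarDual Λ E)) ?_ le_rfl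
    exact (isFlatModule_iff_injective_starDual _).mpr hE.starDual_starDual
  · refine (injectiveDimension_le_starDual_starDual F).trans ?_
    rw [← flatDimension_eq (ModuleCat.of Λ (StarDual Λ F))]
    exact le_iSup₂_of_le (ModuleCat.of Λ (StarDual Λ F))
      ((isFlatModule_iff_injective_starDual _).mp hF) le_rfl

end Dimension

/-! ### The involution of a group ring -/

section GroupRing

variable (R : Type u) [CommRing R] (G : Type v) [Group G]

/-- The anti-automorphism of a group ring inverting the group elements. -/
noncomputable def MonoidAlgebra.invAntiHom :
    MonoidAlgebra R G →ₐ[R] (MonoidAlgebra R G)ᵐᵒᵖ :=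
  MonoidAlgebra.lift R _ G
    { toFun := fun g ↦ MulOpposite.op (MonoidAlgebra.of R G g⁻¹)
      map_one' := by simp [MonoidAlgebra.one_def]
      map_mul' := fun g h ↦ by rw [mul_inv_rev, map_mul, MulOpposite.op_mul] }

theorem MonoidAlgebra.unop_invAntiHom_unop_invAntiHom (x : MonoidAlgebra R G) :
    (invAntiHom R G (invAntiHom R G x).unop).unop = x := by
  induction x using MonoidAlgebra.induction_on with
  | of g => simp [invAntiHom]
  | add x y hx hy => simp [hx, hy]
  | smul r x hx => simp [hx]

/-- The involution of a group ring inverting the group elements. -/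
noncomputable abbrev MonoidAlgebra.invStarRing : StarRing (MonoidAlgebra R G) where
  star x := (invAntiHom R G x).unop
  star_involutive := unop_invAntiHom_unop_invAntiHom R G
  star_mul x y := by simp
  star_add x y := by simp

end GroupRing

theorem proposition5p6 (R : Type u) [CommRing R] (hR : IsCommGorensteinRing R)
    (G : Type v) [Group G] (hRG : IsNoetherianRing (MonoidAlgebra R G)) :
    (sfli (MonoidAlgebra R G) < ⊤ ↔ silf (MonoidAlgebra R G) < ⊤) ∧
      (sfli (MonoidAlgebra R G) < ⊤ → sfli (MonoidAlgebra R G) = silf (MonoidAlgebra R G)) := by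
  let _ := MonoidAlgebra.invStarRing R G
  have h : sfli (MonoidAlgebra R G) = silf (MonoidAlgebra R G) := sfli_eq_silf
  exact ⟨by rw [h], fun _ ↦ h⟩
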